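/- Let $\mathbb{F}$ be $\mathbb{R}$ or $\mathbb{C}$ with complex conjugation as involution (trivial on $\mathbb R$), and let $\mathcal{A}=\mathbb{F}\langle x,x^*\rangle$ be the free $*$-algebra on $x=(x_1,\dots,x_g)$, i.e. the algebra of polynomials over $\mathbb F$ in the $2g$ noncommuting variables $x_1,\dots,x_g,x_1^*,\dots,x_g^*$, with the conjugate-linear involution that reverses words and exchanges $x_j$ and $x_j^*$. For $X=(X_1,\dots,X_g)\in M_n(\mathbb{F})^g$ and $p\in\mathcal{A}$ let $p(X)\in M_n(\mathbb{F})$ be obtained by substituting $X_j$ for $x_j$ and the conjugate transpose $X_j^*$ for $x_j^*$. For a sequence $S=(S_n)_{n\ge 1}$ of subsets $S_n\subseteq M_n(\mathbb F)^g$ put $$\mathcal{I}_{\mathrm{hard}}(S)=\{p\in\mathcal{A}: p(X)=0\text{ for all } n\ge 1\text{ and } X\in S_n\}.$$ For an ideal $I$ of $\mathcal{A}$ let $V_{\mathrm{hard}}(I)_n=\{X\in M_n(\mathbb{F})^g: p(X)=0\text{ for all }p\in I\}$, and let $\sqrt[\mathrm{hard}]{I}=\mathcal{I}_{\mathrm{hard}}(V_{\mathrm{hard}}(I))$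 be the hard radical of $I$. A left ideal $J$ of $\mathcal{A}$ is a $*$-ideal if $J^*=J$, and it is real if, for all finite families $a_1,\dots,a_m\in\mathcal{A}$, $\sum_j a_j^*a_j\in J+J^*$ implies $a_j\in J$ for every $j$. The real radical $\sqrt[\mathrm{real}]{I}$ is the intersection of all real left ideals that contain $I$. Proposition 1.1. Let $I\subseteq\mathcal{A}$ be a two-sided ideal. (i) $I$ is finitely generated as a left ideal if and only if $I=\{0\}$ or $\dim_{\mathbb F}(\mathcal{A}/I)<\infty$. (ii) If $I$ is a $*$-ideal, then $I$ is real and $0<\dim_{\mathbb F}(\mathcal{A}/I)<\infty$ if and only if there exist an integer $n\ge 1$ and an $X\in M_n(\mathbb{F})^g$ such that $I=\mathcal{I}_{\mathrm{hard}}(\{X\})$. Moreover, for every two-sided ideal $I$ (not assumed to be a $*$-ideal), if $0<\dim_{\mathbb F}(\mathcal{A}/\sqrt[\mathrm{real}]{I})<\infty$, then $\sqrt[\mathrm{hard}]{I}=\sqrt[\mathrm{real}]{I}$. -/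

import Mathlib

noncomputable section

/-! ### The free `*`-algebra on `g` generators -/

/-- The involution on words in the letters `x_j` (`Sum.inl j`) and `x_j^*` (`Sum.inr j`):
reverse the word and exchange every `x_j` with `x_j^*`. -/
def wordStar {g : ℕ} (w : FreeMonoid (Fin g ⊕ Fin g)) : FreeMonoid (Fin g ⊕ Fin g) :=
  FreeMonoid.ofList ((FreeMonoid.toList w).map Sum.swap).reverse

theorem wordStar_wordStar {g : ℕ} (w : FreeMonoid (Fin g ⊕ Fin g)) :
    wordStar (wordStar w) = w := by
  simp [wordStar]

theorem wordStar_mul {g : ℕ} (v w : FreeMonoid (Fin g ⊕ Fin g)) :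
    wordStar (v * w) = wordStar w * wordStar v := by
  simp [wordStar]

/-- The algebra `𝕜⟨x, x^*⟩` of polynomials in the `2g` noncommuting variables
`x_1, …, x_g, x_1^*, …, x_g^*`: finite linear combinations of words. -/
abbrev FreeStarAlgebra (𝕜 : Type*) [RCLike 𝕜] (g : ℕ) : Type _ :=
  MonoidAlgebra 𝕜 (FreeMonoid (Fin g ⊕ Fin g))

namespace FreeStarAlgebra

variable {𝕜 : Type*} [RCLike 𝕜] {g : ℕ}

/-- The conjugate-linear extension of `wordStar`: `(∑ c_w w)^* = ∑ conj(c_w) w^*`. -/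
instance instStar : Star (FreeStarAlgebra 𝕜 g) where
  star p := MonoidAlgebra.map (starRingEnd 𝕜).toAddMonoidHom (MonoidAlgebra.mapDomain wordStar p)

theorem star_def (p : FreeStarAlgebra 𝕜 g) :
    star p =
      MonoidAlgebra.map (starRingEnd 𝕜).toAddMonoidHom (MonoidAlgebra.mapDomain wordStar p) :=
  rfl

theorem star_single (w : FreeMonoid (Fin g ⊕ Fin g)) (c : 𝕜) :
    star (MonoidAlgebra.single w c : FreeStarAlgebra 𝕜 g) =
      MonoidAlgebra.single (wordStar w) (star c) := by
  rw [star_def, MonoidAlgebra.mapDomain_single, MonoidAlgebra.map_single]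
  rfl

theorem star_add' (p q : FreeStarAlgebra 𝕜 g) : star (p + q) = star p + star q := by
  rw [star_def, MonoidAlgebra.mapDomain_add, MonoidAlgebra.map_add]
  rfl

theorem star_zero' : star (0 : FreeStarAlgebra 𝕜 g) = 0 := by
  rw [star_def, MonoidAlgebra.mapDomain_zero, MonoidAlgebra.map_zero]

instance instStarRing : StarRing (FreeStarAlgebra 𝕜 g) where
  star_involutive p := by
    induction p using MonoidAlgebra.induction_linear with
    | zero => rw [star_zero', star_zero']
    | add p q hp hq => rw [star_add', star_add', hp, hq]
    | single w c => rw [star_single, star_single, wordStar_wordStar, star_star]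
  star_mul p q := by
    induction p using MonoidAlgebra.induction_linear with
    | zero => rw [zero_mul, star_zero', mul_zero]
    | add p p' hp hp' => rw [add_mul, star_add', star_add', hp, hp', mul_add]
    | single w c =>
      induction q using MonoidAlgebra.induction_linear with
      | zero => rw [mul_zero, star_zero', zero_mul]
      | add q q' hq hq' => rw [mul_add, star_add', star_add', hq, hq', add_mul]
      | single v d =>
        rw [MonoidAlgebra.single_mul_single, star_single, star_single, star_single,
          MonoidAlgebra.single_mul_single, wordStar_mul, star_mul]
  star_add := star_add'

/-- The evaluation homomorphism `p ↦ p(X)`, which substitutes the matrix `X_j` for `x_j` and its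
conjugate transpose for `x_j^*`. -/
def eval {n : ℕ} (X : Fin g → Matrix (Fin n) (Fin n) 𝕜) :
    FreeStarAlgebra 𝕜 g →ₐ[𝕜] Matrix (Fin n) (Fin n) 𝕜 :=
  MonoidAlgebra.lift 𝕜 (Matrix (Fin n) (Fin n) 𝕜) (FreeMonoid (Fin g ⊕ Fin g))
    (FreeMonoid.lift (Sum.elim X fun j => (X j).conjTranspose))

end FreeStarAlgebra

/-! ### Left ideals in `*`-algebras

`Ideal A` is the type of left ideals of the noncommutative ring `A`. -/

/-- `I` is a `*`-ideal: `I^* = I`, where `I^* = {a^* : a ∈ I}`. -/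
def IsStarIdeal {A : Type*} [Ring A] [StarRing A] (I : Ideal A) : Prop :=
  star '' (I : Set A) = (I : Set A)

/-- A left ideal `I` is real if `∑ a_j^* a_j ∈ I + I^*` implies that every `a_j` lies in `I`. -/
def IsRealIdeal {A : Type*} [Ring A] [StarRing A] (I : Ideal A) : Prop :=
  ∀ (n : ℕ) (a : Fin n → A),
    (∃ b ∈ I, ∃ c ∈ I, ∑ j, star (a j) * a j = b + star c) → ∀ j, a j ∈ I

/-- The real radical of `I`: the intersection of all real left ideals that contain `I`. -/
def realRadical {A : Type*} [Ring A] [StarRing A] (I : Ideal A) : Ideal A :=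
  sInf {J : Ideal A | I ≤ J ∧ IsRealIdeal J}

/-- The codimension `dim_𝕜 (A / I)` of a left ideal, as a cardinal. -/
def codim (𝕜 : Type*) {A : Type*} [Field 𝕜] [Ring A] [Algebra 𝕜 A] (I : Ideal A) : Cardinal :=
  Module.rank 𝕜 (A ⧸ I.restrictScalars 𝕜)

/-! ### Hard zeros -/

/-- The graded set of all `g`-tuples of square matrices of the same size `n ≥ 1`.
A subset of it is a sequence `(S_n)` of sets of `g`-tuples of `n × n` matrices. -/
abbrev MatrixTuples (𝕜 : Type*) (g : ℕ) : Type _ :=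
  Σ n : ℕ+, (Fin g → Matrix (Fin n) (Fin n) 𝕜)

/-- The hard vanishing set of `S`: all `p` with `p(X) = 0` for every `X` in `S`. -/
def hardVanishing {𝕜 : Type*} [RCLike 𝕜] {g : ℕ} (S : Set (MatrixTuples 𝕜 g)) :
    Ideal (FreeStarAlgebra 𝕜 g) where
  carrier := {p | ∀ X ∈ S, FreeStarAlgebra.eval X.2 p = 0}
  add_mem' hp hq X hX := by rw [map_add, hp X hX, hq X hX, add_zero]
  zero_mem' X _ := map_zero _
  smul_mem' q p hp X hX := by rw [smul_eq_mul, map_mul, hp X hX, mul_zero]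

/-- The hard variety of `I`: all matrix tuples `X` with `p(X) = 0` for every `p ∈ I`. -/
def hardVariety {𝕜 : Type*} [RCLike 𝕜] {g : ℕ} (I : Ideal (FreeStarAlgebra 𝕜 g)) :
    Set (MatrixTuples 𝕜 g) :=
  {X | ∀ p ∈ I, FreeStarAlgebra.eval X.2 p = 0}

/-- The hard radical of `I`. -/
def hardRadical {𝕜 : Type*} [RCLike 𝕜] {g : ℕ} (I : Ideal (FreeStarAlgebra 𝕜 g)) :
    Ideal (FreeStarAlgebra 𝕜 g) :=
  hardVanishing (hardVariety I)

end

/-! Finite generation. Monomials with different first letters cannot cancel, so an element of `I` of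
degree at most `N + n` is built from `lowDegree I N` by prefixing words of length at most `n`, once
generators have degree at most `N` (`mem_wordMul_of_mem_degreeLT`). Apply this to `p * w`, with `p ≠
0` in `I` and `w` a word of length `N`: stripping a longest word `u` of `p` leaves an element of `I`
with leading part a multiple of `w`. Hence degrees below `N` span the quotient. Conversely, if a
finite-dimensional `V` containing `1` spans modulo `I`, the relations in `I` rewriting each `x_a v`
back into `V` form a finite-dimensional space that generates `I`.

Reality. If `I` is real, two-sided, proper and of finite codimension, sums of hermitian squares in
the quotient vanish only trivially. Separating 0 from their convex hull gives a faithful positive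
functional, and the GNS construction represents the quotient faithfully by matrices; the images of
the variables are the point `X`. Conversely, vanishing ideals of matrix points are real. The real
radical of a two-sided ideal is two-sided and real, so it too is the vanishing ideal of a point, and
that point lies in the hard variety of `I`. -/

namespace FreeMonoidAlgebra

/-! ### Left ideals of free algebras: finite generation and finite codimension. -/

open MonoidAlgebra

variable {k α : Type*} [Field k]

/-- The generator of the free algebra attached to a letter. -/
noncomputable def letter (k : Type*) {α : Type*} [Field k] (a : α) :
    MonoidAlgebra k (FreeMonoid α) :=
  single (FreeMonoid.of a) 1

theorem coeff_letter_mul_same (a : α) (q : MonoidAlgebra k (FreeMonoid α)) (w : FreeMonoid α) :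
    (letter k a * q).coeff (FreeMonoid.of a * w) = q.coeff w := by
  simp [letter, coeff_single_mul_mul]

theorem coeff_letter_mul_of_ne {a b : α} (h : a ≠ b) (q : MonoidAlgebra k (FreeMonoid α))
    (w : FreeMonoid α) : (letter k a * q).coeff (FreeMonoid.of b * w) = 0 := by
  refine coeff_single_mul_of_forall_mul_ne _ _ fun d hd => h ?_
  exact (List.cons.inj hd).1

theorem coeff_letter_mul_one (a : α) (q : MonoidAlgebra k (FreeMonoid α)) :
    (letter k a * q).coeff 1 = 0 := by
  refine coeff_single_mul_of_forall_mul_ne _ _ fun d hd => ?_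
  exact List.cons_ne_nil _ _ hd

theorem letter_mul_single (a : α) (w : FreeMonoid α) (c : k) :
    letter k a * single w c = single (FreeMonoid.of a * w) c := by
  simp [letter]

/-- The polynomials of degree less than `d`. -/
def degreeLT (k α : Type*) [Field k] (d : ℕ) : Submodule k (MonoidAlgebra k (FreeMonoid α)) where
  carrier := {p | ∀ w, d ≤ w.length → p.coeff w = 0}
  add_mem' hp hq w hw := by simp [hp w hw, hq w hw]
  zero_mem' w _ := by simp
  smul_mem' c p hp w hw := by simp [hp w hw]

theorem degreeLT_mono {d e : ℕ} (h : d ≤ e) : degreeLT k α d ≤ degreeLT k α e :=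
  fun _ hp w hw => hp w (h.trans hw)

theorem single_mem_degreeLT {d : ℕ} {w : FreeMonoid α} (h : w.length < d) (c : k) :
    single w c ∈ degreeLT k α d := by
  intro v hv
  have : w ≠ v := by rintro rfl; omega
  simp [this]

theorem exists_mem_degreeLT (p : MonoidAlgebra k (FreeMonoid α)) : ∃ d, p ∈ degreeLT k α d := by
  refine ⟨p.coeff.support.sup FreeMonoid.length + 1, fun w hw => ?_⟩
  by_contra h
  have := Finset.le_sup (f := FreeMonoid.length) (Finsupp.mem_support_iff.2 h)
  omega

/-- A subspace contains `p` once it contains the monomials of `p`. -/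
theorem mem_of_forall_single_mem (T : Submodule k (MonoidAlgebra k (FreeMonoid α)))
    (p : MonoidAlgebra k (FreeMonoid α)) (h : ∀ w, p.coeff w ≠ 0 → single w (1 : k) ∈ T) :
    p ∈ T := by
  have hp : p = ∑ w ∈ p.coeff.support, p.coeff w • single w (1 : k) := by
    apply coeff_injective
    conv_lhs => rw [← Finsupp.sum_single p.coeff]
    simp [Finsupp.sum]
  rw [hp]
  exact T.sum_mem fun w hw => T.smul_mem _ (h w (Finsupp.mem_support_iff.1 hw))

theorem fg_degreeLT [Finite α] (d : ℕ) : (degreeLT k α d).FG := by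
  have hfin : {w : FreeMonoid α | w.length < d}.Finite := List.finite_length_lt α d
  have : degreeLT k α d =
      Submodule.span k ((fun w => single w (1 : k)) '' {w : FreeMonoid α | w.length < d}) := by
    apply le_antisymm
    · intro p hp
      refine mem_of_forall_single_mem _ p fun w hw => Submodule.subset_span ⟨w, ?_, rfl⟩
      by_contra h
      exact hw (hp w (not_lt.1 h))
    · rw [Submodule.span_le]
      rintro _ ⟨w, hw, rfl⟩
      exact single_mem_degreeLT hw 1
  rw [this]
  exact Submodule.fg_span (hfin.image _)

theorem letter_mul_mem_degreeLT {d : ℕ} {p : MonoidAlgebra k (FreeMonoid α)}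
    (hp : p ∈ degreeLT k α d) (a : α) : letter k a * p ∈ degreeLT k α (d + 1) := by
  intro w hw
  induction w using FreeMonoid.casesOn with
  | one => exact coeff_letter_mul_one a p
  | of_mul b v =>
    by_cases h : a = b
    · subst h
      rw [coeff_letter_mul_same]
      rw [FreeMonoid.length_mul, FreeMonoid.length_of] at hw
      exact hp v (by omega)
    · exact coeff_letter_mul_of_ne h p v

theorem coeff_mul_single_of_length_eq (p : MonoidAlgebra k (FreeMonoid α)) (u : FreeMonoid α)
    {w v : FreeMonoid α} (h : v.length = w.length) (hne : v ≠ w) :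
    (p * single w (1 : k)).coeff (u * v) = 0 := by
  refine coeff_mul_single_of_forall_mul_ne _ _ fun d hd => hne ?_
  exact (List.append_inj_right' (s₁ := d.toList) (s₂ := u.toList) hd h.symm).symm

theorem mul_single_mem_degreeLT {d : ℕ} {p : MonoidAlgebra k (FreeMonoid α)}
    (hp : p ∈ degreeLT k α d) (w : FreeMonoid α) (c : k) :
    p * single w c ∈ degreeLT k α (d + w.length) := by
  intro v hv
  by_cases h : ∃ u, u * w = v
  · obtain ⟨u, rfl⟩ := h
    rw [FreeMonoid.length_mul] at hv
    rw [coeff_mul_single_mul, hp u (by omega), zero_mul]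
  · exact coeff_mul_single_of_forall_mul_ne _ _ (not_exists.1 h)

theorem exists_coeff_ne_zero_mem_degreeLT {p : MonoidAlgebra k (FreeMonoid α)} (hp : p ≠ 0) :
    ∃ u, p.coeff u ≠ 0 ∧ p ∈ degreeLT k α (u.length + 1) := by
  have hne : p.coeff.support.Nonempty := by
    rw [Finsupp.support_nonempty_iff]
    simpa using hp
  obtain ⟨u, hu, hmax⟩ := p.coeff.support.exists_max_image FreeMonoid.length hne
  refine ⟨u, Finsupp.mem_support_iff.1 hu, fun w hw => ?_⟩
  by_contra h
  have := hmax w (Finsupp.mem_support_iff.2 h)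
  omega

/-- The elements of `I` of degree at most `N`. -/
noncomputable def lowDegree (I : Ideal (MonoidAlgebra k (FreeMonoid α))) (N : ℕ) :
    Submodule k (MonoidAlgebra k (FreeMonoid α)) :=
  I.restrictScalars k ⊓ degreeLT k α (N + 1)

variable {I : Ideal (MonoidAlgebra k (FreeMonoid α))} {N : ℕ}

section Fintype

variable [Fintype α]

/-- The map `(q_a)_a ↦ ∑ a, x_a q_a`. -/
noncomputable def letterSum (k α : Type*) [Field k] [Fintype α] :
    (α → MonoidAlgebra k (FreeMonoid α)) →ₗ[k] MonoidAlgebra k (FreeMonoid α) :=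
  ∑ a, LinearMap.mulLeft k (letter k a) ∘ₗ LinearMap.proj a

theorem letterSum_apply (q : α → MonoidAlgebra k (FreeMonoid α)) :
    letterSum k α q = ∑ a, letter k a * q a := by
  simp [letterSum]

theorem letterSum_single [DecidableEq α] (a : α) (p : MonoidAlgebra k (FreeMonoid α)) :
    letterSum k α (Pi.single a p) = letter k a * p := by
  rw [letterSum_apply, Finset.sum_eq_single a (fun b _ hb => by simp [hb]) (by simp)]
  simp

/-- Only the summand with first letter `a` contributes. This absence of cancellation is what makes
the degree arguments below work. -/
theorem coeff_letterSum (q : α → MonoidAlgebra k (FreeMonoid α)) (a : α) (w : FreeMonoid α) :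
    (letterSum k α q).coeff (FreeMonoid.of a * w) = (q a).coeff w := by
  rw [letterSum_apply, coeff_sum, Finsupp.finsetSum_apply,
    Finset.sum_eq_single a (fun b _ hb => coeff_letter_mul_of_ne hb _ _) (by simp),
    coeff_letter_mul_same]

/-- The span of all products `u f` with `f ∈ K` and `u` a word of length at most `n`. -/
noncomputable def wordMul (K : Submodule k (MonoidAlgebra k (FreeMonoid α))) :
    ℕ → Submodule k (MonoidAlgebra k (FreeMonoid α))
  | 0 => K
  | n + 1 => K ⊔ (Submodule.pi Set.univ fun _ => wordMul K n).map (letterSum k α)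

variable {K : Submodule k (MonoidAlgebra k (FreeMonoid α))}

theorem mem_wordMul_succ {n : ℕ} {p : MonoidAlgebra k (FreeMonoid α)} :
    p ∈ wordMul K (n + 1) ↔
      ∃ f ∈ K, ∃ q, (∀ a, q a ∈ wordMul K n) ∧ f + letterSum k α q = p := by
  simp [wordMul, Submodule.mem_sup, Submodule.mem_pi]

theorem wordMul_le_succ (n : ℕ) : wordMul K n ≤ wordMul K (n + 1) := by
  induction n with
  | zero => exact le_sup_left
  | succ n ih =>
    intro p hp
    obtain ⟨f, hf, q, hq, rfl⟩ := mem_wordMul_succ.1 hp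
    exact mem_wordMul_succ.2 ⟨f, hf, q, fun a => ih (hq a), rfl⟩

theorem wordMul_mono : Monotone (wordMul K) := monotone_nat_of_le_succ wordMul_le_succ

theorem letter_mul_mem_wordMul {n : ℕ} {p : MonoidAlgebra k (FreeMonoid α)}
    (hp : p ∈ wordMul K n) (a : α) : letter k a * p ∈ wordMul K (n + 1) := by
  classical
  refine mem_wordMul_succ.2 ⟨0, K.zero_mem, Pi.single a p, fun b => ?_, ?_⟩
  · by_cases h : b = a
    · subst h; simpa using hp
    · simp [h]
  · rw [zero_add, letterSum_single]

/-- Every left ideal generated by `K` is exhausted by the `wordMul K n`. -/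
theorem exists_mem_wordMul {s : Set (MonoidAlgebra k (FreeMonoid α))} (hs : s ⊆ K)
    {p : MonoidAlgebra k (FreeMonoid α)} (hp : p ∈ Ideal.span s) : ∃ n, p ∈ wordMul K n := by
  have hdir : Directed (· ≤ ·) (wordMul K) := wordMul_mono.directed_le
  have hword : ∀ (w : FreeMonoid α) (q : MonoidAlgebra k (FreeMonoid α)),
      (∃ n, q ∈ wordMul K n) → ∃ n, single w (1 : k) * q ∈ wordMul K n := by
    intro w q hq
    induction w using FreeMonoid.inductionOn' with
    | one => rwa [← one_def, one_mul]
    | of_mul a v ih =>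
      obtain ⟨n, hn⟩ := ih
      refine ⟨n + 1, ?_⟩
      rw [← letter_mul_single, mul_assoc]
      exact letter_mul_mem_wordMul hn a
  rw [← Submodule.mem_iSup_of_directed _ hdir]
  induction hp using Submodule.span_induction with
  | mem x hx => exact Submodule.mem_iSup_of_mem 0 (hs hx)
  | zero => exact Submodule.zero_mem _
  | add x y _ _ hx hy => exact Submodule.add_mem _ hx hy
  | smul a x _ hx =>
    -- By linearity in the coefficient it suffices to multiply by words.
    have : a ∈ (⨆ n, wordMul K n).comap (LinearMap.mulRight k x) := by
      refine mem_of_forall_single_mem _ a fun w _ => ?_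
      rw [Submodule.mem_iSup_of_directed _ hdir] at hx
      rw [Submodule.mem_comap, LinearMap.mulRight_apply, Submodule.mem_iSup_of_directed _ hdir]
      exact hword w x hx
    exact this

/-- A degree bound on `∑ a, x_a q_a` bounds each `q_a` by one less, which drives the induction. At
`n = 0` each `x_a q_a` has degree at most `N` and lies in `I`, so `lowDegree I N` already contains
it. -/
theorem mem_wordMul_of_mem_succ (n : ℕ) {p : MonoidAlgebra k (FreeMonoid α)}
    (hp : p ∈ wordMul (lowDegree I N) (n + 1)) (hd : p ∈ degreeLT k α (N + 1 + n)) :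
    p ∈ wordMul (lowDegree I N) n := by
  induction n generalizing p with
  | zero =>
    obtain ⟨f, hf, q, hq, rfl⟩ := mem_wordMul_succ.1 hp
    have hsum : letterSum k α q ∈ degreeLT k α (N + 1) := by
      simpa using Submodule.sub_mem _ hd hf.2
    refine Submodule.add_mem _ hf ?_
    rw [letterSum_apply]
    refine Submodule.sum_mem _ fun a _ => ⟨I.mul_mem_left _ (hq a).1, ?_⟩
    refine letter_mul_mem_degreeLT (fun w hw => ?_) a
    rw [← coeff_letterSum]
    exact hsum _ (by rw [FreeMonoid.length_mul, FreeMonoid.length_of]; omega)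
  | succ n ih =>
    obtain ⟨f, hf, q, hq, rfl⟩ := mem_wordMul_succ.1 hp
    have hsum : letterSum k α q ∈ degreeLT k α (N + 1 + (n + 1)) := by
      have := Submodule.sub_mem _ hd (degreeLT_mono (Nat.le_add_right _ (n + 1)) hf.2)
      simpa using this
    refine mem_wordMul_succ.2 ⟨f, hf, q, fun a => ih (hq a) fun w hw => ?_, rfl⟩
    rw [← coeff_letterSum]
    exact hsum _ (by rw [FreeMonoid.length_mul, FreeMonoid.length_of]; omega)

theorem mem_wordMul_of_mem_degreeLT {s : Set (MonoidAlgebra k (FreeMonoid α))}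
    (hs : Ideal.span s = I) (hsN : s ⊆ degreeLT k α (N + 1)) (n : ℕ)
    {p : MonoidAlgebra k (FreeMonoid α)} (hp : p ∈ I) (hd : p ∈ degreeLT k α (N + 1 + n)) :
    p ∈ wordMul (lowDegree I N) n := by
  have hsK : s ⊆ lowDegree I N := fun x hx => ⟨hs ▸ Ideal.subset_span hx, hsN hx⟩
  obtain ⟨m, hm⟩ := exists_mem_wordMul hsK (hs ▸ hp)
  have key : ∀ j, p ∈ wordMul (lowDegree I N) (n + j) → p ∈ wordMul (lowDegree I N) n := by
    intro j
    induction j with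
    | zero => exact id
    | succ j ih => exact fun h => ih (mem_wordMul_of_mem_succ _ h (degreeLT_mono (by omega) hd))
  exact key m (wordMul_mono (Nat.le_add_left m n) hm)

/-- The part of `p` beginning with a word `u` agrees, in degree `N`, with an element of
`lowDegree I N`. -/
theorem exists_coeff_eq_of_mem_wordMul {u : FreeMonoid α} {p : MonoidAlgebra k (FreeMonoid α)}
    (hp : p ∈ wordMul (lowDegree I N) u.length) :
    ∃ f ∈ lowDegree I N, ∀ w : FreeMonoid α, w.length = N → f.coeff w = p.coeff (u * w) := by
  induction u using FreeMonoid.inductionOn' generalizing p with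
  | one => exact ⟨p, hp, fun w _ => by rw [one_mul]⟩
  | of_mul a v ih =>
    rw [FreeMonoid.length_mul, FreeMonoid.length_of, add_comm] at hp
    obtain ⟨f, hf, q, hq, rfl⟩ := mem_wordMul_succ.1 hp
    obtain ⟨f', hf', h⟩ := ih (hq a)
    refine ⟨f', hf', fun w hw => ?_⟩
    -- The word `a v w` is longer than `N`, so `f` has no coefficient there.
    rw [h w hw, mul_assoc, coeff_add, Finsupp.add_apply, coeff_letterSum, hf.2, zero_add]
    simp only [FreeMonoid.length_mul, FreeMonoid.length_of]
    omega

/-- A nonzero two-sided ideal of a free algebra which is finitely generated as a left ideal has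
finite codimension. -/
theorem finite_quotient_of_fg [I.IsTwoSided] (hI : I.FG) (h0 : I ≠ ⊥) :
    Module.Finite k (MonoidAlgebra k (FreeMonoid α) ⧸ I.restrictScalars k) := by
  obtain ⟨s, hs⟩ := hI
  choose d hd using exists_mem_degreeLT (k := k) (α := α)
  set N := s.sup d with hN
  have hsN : (s : Set (MonoidAlgebra k (FreeMonoid α))) ⊆ degreeLT k α (N + 1) := fun x hx =>
    degreeLT_mono ((Finset.le_sup (f := d) hx).trans (Nat.le_succ _)) (hd x)
  obtain ⟨p, hpI, hp0⟩ := Submodule.exists_mem_ne_zero_of_ne_bot h0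
  obtain ⟨u, hu, hpu⟩ := exists_coeff_ne_zero_mem_degreeLT hp0
  set T := I.restrictScalars k ⊔ degreeLT k α N with hT
  have hword : ∀ w : FreeMonoid α, w.length ≤ N → single w (1 : k) ∈ T := by
    intro w hw
    rcases hw.lt_or_eq with hw | hw
    · exact Submodule.mem_sup_right (single_mem_degreeLT hw 1)
    -- Two-sidedness enters here: `p * w` stays in `I`. Among words `u w'` with `w'` of length `N`,
    -- only `u w` occurs in it.
    have hmem : p * single w (1 : k) ∈ wordMul (lowDegree I N) u.length := by
      refine mem_wordMul_of_mem_degreeLT hs hsN _ (I.mul_mem_right _ hpI) ?_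
      exact degreeLT_mono (by omega) (mul_single_mem_degreeLT hpu w 1)
    obtain ⟨f, hf, hfw⟩ := exists_coeff_eq_of_mem_wordMul hmem
    have hrest : single w (1 : k) - (p.coeff u)⁻¹ • f ∈ degreeLT k α N := by
      intro v hv
      rcases hv.eq_or_lt with hv | hv
      · by_cases hvw : v = w
        · subst hvw
          simp [hfw v hw, hu]
        · have := coeff_mul_single_of_length_eq p u (hv.symm.trans hw.symm) hvw
          simp [hfw v hv.symm, this, Ne.symm hvw]
      · have h1 := hf.2 v hv
        have h2 : w ≠ v := by rintro rfl; omega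
        simp [h1, h2]
    rw [← add_sub_cancel ((p.coeff u)⁻¹ • f) (single w (1 : k))]
    exact Submodule.add_mem_sup ((I.restrictScalars k).smul_mem _ hf.1) hrest
  -- Prefixing a letter raises the degree to at most `N`, where `hword` applies.
  have hmul : ∀ (a : α) (q), q ∈ T → letter k a * q ∈ T := by
    intro a q hq
    obtain ⟨i, hi, r, hr, rfl⟩ := Submodule.mem_sup.1 hq
    rw [mul_add]
    refine T.add_mem (Submodule.mem_sup_left (I.mul_mem_left _ hi)) ?_
    refine mem_of_forall_single_mem T _ fun w hw => hword w ?_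
    by_contra h
    exact hw (letter_mul_mem_degreeLT hr a w (by omega))
  have htop : T = ⊤ := by
    refine eq_top_iff.2 fun q _ => mem_of_forall_single_mem T q fun w hqw => ?_
    clear hqw
    induction w using FreeMonoid.inductionOn' with
    | one => exact hword 1 (by simp)
    | of_mul a v ih => rw [← letter_mul_single]; exact hmul a _ ih
  have hmap : (degreeLT k α N).map (I.restrictScalars k).mkQ = ⊤ := by
    rw [← (Submodule.map_mkQ_eq_top _ _).2 htop]
  exact ⟨hmap ▸ (fg_degreeLT N).map _⟩

/-- A left ideal of finite codimension in a free algebra on finitely many letters is finitely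
generated. -/
theorem fg_of_finite_quotient (I : Ideal (MonoidAlgebra k (FreeMonoid α)))
    (h : Module.Finite k (MonoidAlgebra k (FreeMonoid α) ⧸ I.restrictScalars k)) : I.FG := by
  obtain ⟨V₀, hV₀, hmap⟩ : ∃ V₀ : Submodule k (MonoidAlgebra k (FreeMonoid α)), V₀.FG ∧
      V₀.map (I.restrictScalars k).mkQ = ⊤ := by
    obtain ⟨t, ht⟩ := h.fg_top
    have hsec := Function.rightInverse_surjInv (I.restrictScalars k).mkQ_surjective
    refine ⟨Submodule.span k (Function.surjInv (I.restrictScalars k).mkQ_surjective '' t),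
      Submodule.fg_span (t.finite_toSet.image _), ?_⟩
    rw [Submodule.map_span, ← ht, hsec.image_image]
  -- Adjoining `1` starts the induction on words in `htop`.
  set V := V₀ ⊔ Submodule.span k {1} with hV
  have hVfg : V.FG := hV₀.sup (Submodule.fg_span_singleton 1)
  have hVI : V ⊔ I.restrictScalars k = ⊤ := by
    rw [Submodule.map_mkQ_eq_top] at hmap
    refine eq_top_iff.2 (hmap ▸ ?_)
    exact sup_le le_sup_right (le_sup_left.trans le_sup_left)
  set V' := V ⊔ ⨆ a, V.map (LinearMap.mulLeft k (letter k a)) with hV'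
  have hV'fg : V'.FG := hVfg.sup (Submodule.fg_iSup _ fun a => hVfg.map _)
  -- `W` holds the errors `x_a v - v'` with `v, v' ∈ V`, and also `V ∩ I`.
  set W := V' ⊓ I.restrictScalars k
  have hWfg : W.FG := by
    have : FiniteDimensional k V' := Module.Finite.iff_fg.2 hV'fg
    have : FiniteDimensional k W := Submodule.finiteDimensional_of_le inf_le_left
    exact Module.Finite.iff_fg.1 this
  obtain ⟨t, ht⟩ := hWfg
  set J : Ideal (MonoidAlgebra k (FreeMonoid α)) := Ideal.span t with hJ
  have hWJ : W ≤ J.restrictScalars k := ht ▸ Submodule.span_le_restrictScalars k _ _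
  have hJI : J ≤ I := Ideal.span_le.2 fun x hx => (ht ▸ Submodule.subset_span hx : x ∈ W).2
  have htop : V ⊔ J.restrictScalars k = ⊤ := by
    refine eq_top_iff.2 fun q _ => mem_of_forall_single_mem _ q fun w hqw => ?_
    clear hqw
    induction w using FreeMonoid.inductionOn' with
    | one =>
      exact Submodule.mem_sup_left (Submodule.mem_sup_right (Submodule.mem_span_singleton_self 1))
    | of_mul a v ih =>
      rw [← letter_mul_single]
      obtain ⟨x, hx, y, hy, hxy⟩ := Submodule.mem_sup.1 ih
      rw [← hxy, mul_add]
      refine Submodule.add_mem _ ?_ (Submodule.mem_sup_right (J.mul_mem_left _ hy))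
      obtain ⟨x', hx', z, hz, hxz⟩ := Submodule.mem_sup.1
        (hVI ▸ Submodule.mem_top : letter k a * x ∈ V ⊔ I.restrictScalars k)
      rw [← hxz]
      refine Submodule.add_mem_sup hx' (hWJ ⟨?_, hz⟩)
      have : z = letter k a * x - x' := by rw [← hxz]; simp
      rw [this]
      refine V'.sub_mem (Submodule.mem_sup_right ?_) (Submodule.mem_sup_left hx')
      exact Submodule.mem_iSup_of_mem a ⟨x, hx, rfl⟩
  refine ⟨t, le_antisymm hJI fun p hp => ?_⟩
  obtain ⟨x, hx, y, hy, hxy⟩ := Submodule.mem_sup.1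
    (htop ▸ Submodule.mem_top : p ∈ V ⊔ J.restrictScalars k)
  rw [← hxy]
  refine J.add_mem (hWJ ⟨Submodule.mem_sup_left hx, ?_⟩) hy
  have : x = p - y := by rw [← hxy]; simp
  rw [this]
  exact I.sub_mem hp (hJI hy)

end Fintype

end FreeMonoidAlgebra

/-! ### Compactness of convex hulls. -/

theorem Function.Embedding.sum_extend_zero {ι κ M : Type*} [Fintype ι] [Fintype κ] [AddCommMonoid M]
    (e : ι ↪ κ) (f : ι → M) : ∑ i, Function.extend e f 0 i = ∑ i, f i := by
  rw [← Finset.sum_subset (Finset.subset_univ (Finset.univ.map e)), Finset.sum_map]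
  · simp [e.injective.extend_apply]
  · intro i _ hi
    rw [Function.extend_apply']
    · rfl
    · simpa using hi

/-- In a finite-dimensional real vector space, the convex hull of a compact set is compact. -/
theorem IsCompact.convexHull_of_finiteDimensional {E : Type*} [NormedAddCommGroup E]
    [NormedSpace ℝ E] [FiniteDimensional ℝ E] {s : Set E} (hs : IsCompact s) :
    IsCompact (convexHull ℝ s) := by
  rcases s.eq_empty_or_nonempty with rfl | ⟨x₀, hx₀⟩
  · simp
  -- Carathéodory: this many points suffice, so the hull is a continuous image of a compact product.
  let d := Module.finrank ℝ E + 1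
  let F : (Fin d → ℝ) × (Fin d → E) → E := fun p => ∑ i, p.1 i • p.2 i
  have hF : Continuous F := by fun_prop
  have hK : IsCompact (stdSimplex ℝ (Fin d) ×ˢ Set.pi Set.univ fun _ : Fin d => s) :=
    (isCompact_stdSimplex ℝ (Fin d)).prod (isCompact_univ_pi fun _ => hs)
  convert hK.image hF
  apply Set.Subset.antisymm
  · intro x hx
    obtain ⟨ι, _, z, w, hz, hind, hw, hw1, rfl⟩ := eq_pos_convex_span_of_mem_convexHull hx
    have hcard : Fintype.card ι ≤ Fintype.card (Fin d) := by
      rw [Fintype.card_fin]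
      exact hind.card_le_finrank_succ.trans
        (Nat.succ_le_succ (Submodule.finrank_le _))
    obtain ⟨e⟩ := Function.Embedding.nonempty_of_card_le hcard
    -- Pad to exactly `d` points by copies of `x₀` with weight 0.
    refine ⟨(Function.extend e w 0, Function.extend e z fun _ => x₀), ⟨⟨fun i => ?_, ?_⟩, ?_⟩, ?_⟩
    · by_cases h : ∃ a, e a = i
      · obtain ⟨a, rfl⟩ := h
        simpa [e.injective.extend_apply] using (hw a).le
      · simp [Function.extend_apply' _ _ _ h]
    · exact (e.sum_extend_zero w).trans hw1
    · intro i _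
      by_cases h : ∃ a, e a = i
      · obtain ⟨a, rfl⟩ := h
        simpa [e.injective.extend_apply] using hz ⟨a, rfl⟩
      · simpa [Function.extend_apply' _ _ _ h] using hx₀
    · rw [← e.sum_extend_zero fun i => w i • z i]
      refine Finset.sum_congr rfl fun i _ => ?_
      by_cases h : ∃ a, e a = i
      · obtain ⟨a, rfl⟩ := h
        simp [e.injective.extend_apply]
      · simp [Function.extend_apply' _ _ _ h]
  · rintro _ ⟨⟨w, z⟩, ⟨hw, hz⟩, rfl⟩
    exact (convex_convexHull ℝ s).sum_mem (fun i _ => hw.1 i) hw.2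
      fun i _ => subset_convexHull ℝ s (hz i trivial)

/-! ### Faithful functionals and the GNS construction. -/

section FormallyReal

variable {𝕜 B : Type*} [RCLike 𝕜] [Ring B] [StarRing B] [Algebra 𝕜 B] [StarModule 𝕜 B]
  [FiniteDimensional 𝕜 B]

/-- If sums of hermitian squares vanish only trivially, then there is a faithful positive
functional. -/
theorem exists_faithful_functional
    (hB : ∀ (m : ℕ) (b : Fin m → B), ∑ j, star (b j) * b j = 0 → ∀ j, b j = 0) :
    ∃ τ : B →ₗ[𝕜] 𝕜, (∀ b, τ (star b) = star (τ b)) ∧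
      ∀ b, b ≠ 0 → 0 < RCLike.re (τ (star b * b)) := by
  let v := Module.finBasis 𝕜 B
  let E := Fin (Module.finrank 𝕜 B) → 𝕜
  let e : B ≃ₗ[𝕜] E := v.equivFun
  let q : E → E := fun x => e (star (e.symm x) * e.symm x)
  have hq : Continuous q := by
    have : q = fun x => ∑ i, ∑ j, (star (x i) * x j) • e (star (v i) * v j) := by
      funext x
      have hx : e.symm x = ∑ i, x i • v i := v.equivFun_symm_apply x
      simp only [q, hx, star_sum, Finset.sum_mul_sum, map_sum, star_smul, smul_mul_smul_comm,
        map_smul]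
    rw [this]
    fun_prop
  let s : Set E := q '' Metric.sphere 0 1
  have hs : IsCompact (convexHull ℝ s) :=
    ((isCompact_sphere 0 1).image hq).convexHull_of_finiteDimensional
  have h0 : (0 : E) ∉ convexHull ℝ s := by
    intro h
    obtain ⟨ι, _, z, w, hz, -, hw, hw1, hsum⟩ := eq_pos_convex_span_of_mem_convexHull h
    have hz' : ∀ i, ∃ x ∈ Metric.sphere (0 : E) 1, q x = z i := fun i => hz ⟨i, rfl⟩
    choose x hx hxz using hz'
    -- Square roots absorb the weights, turning a convex combination equal to 0 into a vanishing sum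
    -- of hermitian squares.
    let b : ι → B := fun i => ((Real.sqrt (w i) : ℝ) : 𝕜) • e.symm (x i)
    have hb : ∑ i, star (b i) * b i = 0 := by
      apply e.injective
      rw [map_sum, map_zero, ← hsum]
      refine Finset.sum_congr rfl fun i _ => ?_
      rw [← hxz i]
      simp only [b, q, star_smul, smul_mul_smul_comm, map_smul]
      rw [RCLike.star_def, RCLike.conj_ofReal, ← RCLike.ofReal_mul, Real.mul_self_sqrt (hw i).le]
      funext j
      simp
    let f := Fintype.equivFin ι
    have hb0 := hB _ (b ∘ f.symm) (by
      rw [← hb]; exact Equiv.sum_comp f.symm fun i => star (b i) * b i)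
    have : Nonempty ι := by
      by_contra hne
      rw [not_nonempty_iff] at hne
      simp at hw1
    obtain ⟨i⟩ := this
    have hi : b i = 0 := by simpa using hb0 (f i)
    rcases smul_eq_zero.1 hi with hi | hi
    · exact (Real.sqrt_pos.2 (hw i)).ne' (RCLike.ofReal_eq_zero.1 hi)
    · have hxi : x i = 0 := by simpa using hi
      have := hx i
      rw [hxi] at this
      simp at this
  obtain ⟨f, u, hfu, hfs⟩ := RCLike.geometric_hahn_banach_point_closed (𝕜 := 𝕜)
    (convex_convexHull ℝ s) hs.isClosed h0
  rw [map_zero, map_zero] at hfu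
  let σ : B →ₗ[𝕜] 𝕜 := (f : E →ₗ[𝕜] 𝕜) ∘ₗ (e : B →ₗ[𝕜] E)
  have hσ : ∀ b, b ≠ 0 → 0 < RCLike.re (σ (star b * b)) := by
    intro b hb
    have hne : ‖e b‖ ≠ 0 := norm_ne_zero_iff.2 (e.map_ne_zero_iff.2 hb)
    have hmem : q (((‖e b‖⁻¹ : ℝ) : 𝕜) • e b) ∈ s := by
      refine ⟨_, ?_, rfl⟩
      rw [mem_sphere_zero_iff_norm, norm_smul, RCLike.norm_ofReal, abs_of_nonneg (by positivity),
        inv_mul_cancel₀ hne]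
    have h1 := hfu.trans (hfs _ (subset_convexHull ℝ s hmem))
    have h2 : f (q (((‖e b‖⁻¹ : ℝ) : 𝕜) • e b)) =
        ((‖e b‖⁻¹ * ‖e b‖⁻¹ : ℝ) : 𝕜) * σ (star b * b) := by
      simp only [q, σ, map_smul, LinearEquiv.symm_apply_apply, star_smul, smul_mul_smul_comm]
      rw [RCLike.star_def, RCLike.conj_ofReal, ← RCLike.ofReal_mul]
      rfl
    rw [h2, RCLike.re_ofReal_mul] at h1
    exact pos_of_mul_pos_right h1 (by positivity)
  -- Symmetrizing makes the functional hermitian and keeps the real part of its values on hermitian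
  -- squares.
  refine ⟨{ toFun := fun b => (σ b + star (σ (star b))) / 2, map_add' := ?_, map_smul' := ?_ },
    ?_, ?_⟩
  · intro a b
    simp only [star_add, map_add]
    ring
  · intro c b
    simp only [star_smul, map_smul, smul_eq_mul, star_mul', star_star, RingHom.id_apply]
    ring
  · intro b
    simp only [LinearMap.coe_mk, AddHom.coe_mk, star_star, star_div₀, star_add, star_ofNat]
    rw [add_comm]
  · intro b hb
    have : (σ (star b * b) + star (σ (star b * b))) / 2 =
        ((RCLike.re (σ (star b * b)) : ℝ) : 𝕜) := by
      rw [RCLike.star_def, RCLike.add_conj]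
      simp
    simp only [LinearMap.coe_mk, AddHom.coe_mk, star_mul, star_star]
    rw [this, RCLike.ofReal_re]
    exact hσ b hb

/-- A finite-dimensional `*`-algebra in which sums of hermitian squares vanish only trivially is
isomorphic to a `*`-algebra of matrices. -/
theorem exists_injective_matrix_representation [Nontrivial B]
    (hB : ∀ (m : ℕ) (b : Fin m → B), ∑ j, star (b j) * b j = 0 → ∀ j, b j = 0) :
    ∃ (n : ℕ+) (φ : B →ₐ[𝕜] Matrix (Fin n) (Fin n) 𝕜), Function.Injective φ ∧
      ∀ b, φ (star b) = (φ b).conjTranspose := by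
  obtain ⟨τ, hτs, hτ⟩ := exists_faithful_functional (𝕜 := 𝕜) hB
  let core : InnerProductSpace.Core 𝕜 B :=
    { inner := fun a b => τ (star a * b)
      conj_inner_symm := fun a b => by
        rw [← RCLike.star_def, ← hτs, star_mul, star_star]
      re_inner_nonneg := fun a => by
        by_cases ha : a = 0
        · simp [ha]
        · exact (hτ a ha).le
      add_left := fun a b c => by rw [star_add, add_mul, map_add]
      smul_left := fun a b r => by
        rw [star_smul, smul_mul_assoc, map_smul, smul_eq_mul, RCLike.star_def]
      definite := fun a ha => by
        by_contra h
        have := hτ a h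
        rw [show τ (star a * a) = 0 from ha, map_zero] at this
        exact this.false }
  let : NormedAddCommGroup B := core.toNormedAddCommGroup
  let : InnerProductSpace 𝕜 B := InnerProductSpace.ofCore core.toCore
  have hinner : ∀ a b : B, inner 𝕜 a b = τ (star a * b) := fun _ _ => rfl
  let v := stdOrthonormalBasis 𝕜 B
  let M := LinearMap.toMatrixOrthonormal v
  refine ⟨⟨Module.finrank 𝕜 B, Module.finrank_pos⟩,
    (AlgHomClass.toAlgHom M.toAlgEquiv).comp (Algebra.lmul 𝕜 B), ?_, fun b => ?_⟩
  · exact M.injective.comp Algebra.lmul_injective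
  -- Both sides pair to `τ (x^* b y)`.
  · have hadj : Algebra.lmul 𝕜 B (star b) = star (Algebra.lmul 𝕜 B b) := by
      refine (LinearMap.eq_adjoint_iff _ _).2 fun x y => ?_
      rw [hinner, hinner]
      simp [mul_assoc]
    change M (Algebra.lmul 𝕜 B (star b)) = star (M (Algebra.lmul 𝕜 B b))
    rw [hadj, map_star]

end FormallyReal

/-! ### Real ideals and quotients by `*`-ideals. -/

section StarIdeals

variable {A : Type*} [Ring A]

/-- The left ideal `{a | a r ∈ J}`. -/
def Ideal.rightTranslate (J : Ideal A) (r : A) : Ideal A :=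
  Submodule.comap (LinearMap.toSpanSingleton A A r) J

theorem Ideal.mem_rightTranslate {J : Ideal A} {r a : A} :
    a ∈ J.rightTranslate r ↔ a * r ∈ J := Iff.rfl

variable [StarRing A]

theorem IsStarIdeal.star_mem {I : Ideal A} (hI : IsStarIdeal I) {a : A} (ha : a ∈ I) :
    star a ∈ I := by
  have : star a ∈ star '' (I : Set A) := ⟨a, ha, rfl⟩
  rwa [hI] at this

theorem isStarIdeal_of_star_mem {I : Ideal A} (h : ∀ a ∈ I, star a ∈ I) : IsStarIdeal I := by
  apply Set.Subset.antisymm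
  · rintro _ ⟨a, ha, rfl⟩
    exact h a ha
  · exact fun a ha => ⟨star a, h a ha, star_star a⟩

theorem IsRealIdeal.sInf {S : Set (Ideal A)} (hS : ∀ J ∈ S, IsRealIdeal J) :
    IsRealIdeal (sInf S) := by
  rintro n a ⟨b, hb, c, hc, h⟩ j
  rw [Submodule.mem_sInf] at *
  exact fun J hJ => hS J hJ n a ⟨b, hb J hJ, c, hc J hJ, h⟩ j

/-- Conjugating `∑ a_j^* a_j` by `r` gives `∑ (a_j r)^* (a_j r)`. This is what makes the real
radical of a two-sided ideal two-sided. -/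
theorem IsRealIdeal.rightTranslate {J : Ideal A} (hJ : IsRealIdeal J) (r : A) :
    IsRealIdeal (J.rightTranslate r) := by
  rintro n a ⟨b, hb, c, hc, h⟩ j
  rw [Ideal.mem_rightTranslate] at *
  refine hJ n (fun j => a j * r) ⟨star r * (b * r), J.mul_mem_left _ hb, star r * (c * r),
    J.mul_mem_left _ hc, ?_⟩ j
  have : ∑ j, star (a j * r) * (a j * r) = star r * (∑ j, star (a j) * a j) * r := by
    simp only [Finset.mul_sum, Finset.sum_mul, star_mul, mul_assoc]
  rw [this, h]
  simp only [star_mul, star_star]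
  noncomm_ring

theorem le_realRadical (I : Ideal A) : I ≤ realRadical I := le_sInf fun _ hJ => hJ.1

theorem realRadical_le {I J : Ideal A} (h : I ≤ J) (hJ : IsRealIdeal J) : realRadical I ≤ J :=
  sInf_le ⟨h, hJ⟩

theorem isRealIdeal_realRadical (I : Ideal A) : IsRealIdeal (realRadical I) :=
  IsRealIdeal.sInf fun _ hJ => hJ.2

instance isTwoSided_realRadical (I : Ideal A) [I.IsTwoSided] : (realRadical I).IsTwoSided where
  mul_mem_of_left {a} r ha := by
    have h : I ≤ (realRadical I).rightTranslate r := fun x hx =>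
      le_realRadical I (I.mul_mem_right r hx)
    exact realRadical_le h ((isRealIdeal_realRadical I).rightTranslate r) ha

/-- The hermitian square of `a^*` is `a a^*`, which lies in `I` by right multiplication. -/
theorem IsRealIdeal.isStarIdeal {I : Ideal A} [I.IsTwoSided] (hI : IsRealIdeal I) :
    IsStarIdeal I := by
  refine isStarIdeal_of_star_mem fun a ha => ?_
  refine hI 1 (fun _ => star a) ⟨a * star a, I.mul_mem_right _ ha, 0, I.zero_mem, ?_⟩ 0
  simp

theorem star_mk_out {I : Ideal A} [I.IsTwoSided] (hI : IsStarIdeal I) (a : A) :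
    Ideal.Quotient.mk I (star (Quotient.out (Ideal.Quotient.mk I a))) =
      Ideal.Quotient.mk I (star a) := by
  rw [Ideal.Quotient.eq, ← star_sub]
  refine hI.star_mem ((Ideal.Quotient.eq).1 ?_)
  exact Quotient.out_eq _

/-- The quotient of a `*`-ring by a two-sided `*`-ideal is a `*`-ring. -/
@[reducible]
noncomputable def IsStarIdeal.quotientStarRing {I : Ideal A} [I.IsTwoSided] (hI : IsStarIdeal I) :
    StarRing (A ⧸ I) where
  star x := Ideal.Quotient.mk I (star (Quotient.out x))
  star_involutive x := by
    obtain ⟨a, rfl⟩ := Ideal.Quotient.mk_surjective x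
    simp only [star_mk_out hI, star_star]
  star_mul x y := by
    obtain ⟨a, rfl⟩ := Ideal.Quotient.mk_surjective x
    obtain ⟨b, rfl⟩ := Ideal.Quotient.mk_surjective y
    simp only [← map_mul, star_mk_out hI, star_mul]
  star_add x y := by
    obtain ⟨a, rfl⟩ := Ideal.Quotient.mk_surjective x
    obtain ⟨b, rfl⟩ := Ideal.Quotient.mk_surjective y
    simp only [← map_add, star_mk_out hI, star_add]

end StarIdeals

/-! ### Codimension. -/

section Codimension

variable {k A : Type*} [Field k] [Ring A] [Algebra k A] {I : Ideal A}

theorem codim_lt_aleph0_iff :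
    codim k I < Cardinal.aleph0 ↔ Module.Finite k (A ⧸ I.restrictScalars k) :=
  Module.rank_lt_aleph0_iff

theorem codim_pos_iff : 0 < codim k I ↔ I ≠ ⊤ := by
  rw [codim, rank_pos_iff_nontrivial, Submodule.Quotient.nontrivial_iff, ne_eq,
    Submodule.restrictScalars_eq_top_iff]

end Codimension

/-! ### Matrix evaluations and their vanishing ideals. -/

namespace FreeStarAlgebra

variable {𝕜 : Type*} [RCLike 𝕜] {g : ℕ}

instance instStarModule : StarModule 𝕜 (FreeStarAlgebra 𝕜 g) where
  star_smul c p := by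
    induction p using MonoidAlgebra.induction_linear with
    | zero => simp
    | add p q hp hq => rw [smul_add, star_add, star_add, hp, hq, smul_add]
    | single w d =>
      rw [MonoidAlgebra.smul_single, star_single, star_single, MonoidAlgebra.smul_single,
        smul_eq_mul, smul_eq_mul, star_mul']

/-- The variable `x_j`. -/
noncomputable def var (𝕜 : Type*) [RCLike 𝕜] {g : ℕ} (j : Fin g) : FreeStarAlgebra 𝕜 g :=
  MonoidAlgebra.single (FreeMonoid.of (Sum.inl j)) 1

theorem star_var (j : Fin g) :
    star (var 𝕜 j) = MonoidAlgebra.single (FreeMonoid.of (Sum.inr j)) 1 := by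
  rw [var, star_single, star_one]
  rfl

variable {n : ℕ}

theorem eval_single_of (X : Fin g → Matrix (Fin n) (Fin n) 𝕜) (a : Fin g ⊕ Fin g) :
    eval X (MonoidAlgebra.single (FreeMonoid.of a) 1) =
      Sum.elim X (fun j => (X j).conjTranspose) a := by
  simp [eval]

/-- A `*`-representation of the free `*`-algebra is evaluation at the images of the variables. -/
theorem eq_eval (φ : FreeStarAlgebra 𝕜 g →ₐ[𝕜] Matrix (Fin n) (Fin n) 𝕜)
    (hφ : ∀ p, φ (star p) = (φ p).conjTranspose) : φ = eval fun j => φ (var 𝕜 j) := by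
  apply MonoidAlgebra.algHom_ext'
  swap
  · ext
  refine FreeMonoid.hom_eq fun a => ?_
  change φ (MonoidAlgebra.single (FreeMonoid.of a) 1) =
    eval _ (MonoidAlgebra.single (FreeMonoid.of a) 1)
  rw [eval_single_of]
  cases a with
  | inl j => rfl
  | inr j => rw [← star_var, hφ]; rfl

theorem eval_star (X : Fin g → Matrix (Fin n) (Fin n) 𝕜) (p : FreeStarAlgebra 𝕜 g) :
    eval X (star p) = (eval X p).conjTranspose := by
  induction p using MonoidAlgebra.induction_linear with
  | zero => simp
  | add p q hp hq => rw [star_add, map_add, map_add, hp, hq, Matrix.conjTranspose_add]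
  | single w c =>
    induction w using FreeMonoid.inductionOn' generalizing c with
    | one =>
      rw [star_single, show wordStar (1 : FreeMonoid (Fin g ⊕ Fin g)) = 1 from rfl]
      simp [eval, Matrix.conjTranspose_smul]
    | of_mul a w ih =>
      have h : (MonoidAlgebra.single (FreeMonoid.of a * w) c : FreeStarAlgebra 𝕜 g) =
          MonoidAlgebra.single (FreeMonoid.of a) 1 * MonoidAlgebra.single w c := by simp
      rw [h, star_mul, map_mul, map_mul, ih, Matrix.conjTranspose_mul, star_single, star_one]
      congr 1
      rw [eval_single_of]
      cases a with
      | inl j => exact eval_single_of X (Sum.inr j)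
      | inr j =>
        refine (eval_single_of X (Sum.inl j)).trans ?_
        simp

theorem hardVanishing_anti {S T : Set (MatrixTuples 𝕜 g)} (h : S ⊆ T) :
    hardVanishing T ≤ hardVanishing S := fun _ hp X hX => hp X (h hX)

theorem mem_hardVanishing_singleton {n : ℕ+} {X : Fin g → Matrix (Fin n) (Fin n) 𝕜}
    {p : FreeStarAlgebra 𝕜 g} : p ∈ hardVanishing {(⟨n, X⟩ : MatrixTuples 𝕜 g)} ↔
      eval X p = 0 := by
  refine ⟨fun h => h ⟨n, X⟩ rfl, ?_⟩
  rintro h _ rfl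
  exact h

open scoped Matrix ComplexOrder in
theorem isRealIdeal_hardVanishing (S : Set (MatrixTuples 𝕜 g)) :
    IsRealIdeal (hardVanishing S) := by
  rintro m a ⟨b, hb, c, hc, h⟩ j X hX
  have hsum : ∑ j, (eval X.2 (a j))ᴴ * eval X.2 (a j) = 0 := by
    have := congrArg (eval X.2) h
    rw [map_add, eval_star, hb X hX, hc X hX, Matrix.conjTranspose_zero, add_zero, map_sum] at this
    simpa only [map_mul, eval_star] using this
  ext r s
  -- The diagonal entry at `s` is the sum of squared norms of the columns `s`.
  have hs : ∑ i, ∑ t, ‖eval X.2 (a i) t s‖ ^ 2 = 0 := by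
    have := congrFun (congrFun hsum s) s
    simp only [Matrix.sum_apply, Matrix.mul_apply, Matrix.conjTranspose_apply, RCLike.star_def,
      RCLike.conj_mul, Matrix.zero_apply] at this
    exact_mod_cast this
  rw [Finset.sum_eq_zero_iff_of_nonneg fun i _ => Finset.sum_nonneg fun t _ => by positivity] at hs
  have hj := hs j (Finset.mem_univ j)
  rw [Finset.sum_eq_zero_iff_of_nonneg fun t _ => by positivity] at hj
  simpa using hj r (Finset.mem_univ r)

theorem hardVanishing_singleton_ne_top {n : ℕ+} (X : Fin g → Matrix (Fin n) (Fin n) 𝕜) :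
    hardVanishing {(⟨n, X⟩ : MatrixTuples 𝕜 g)} ≠ ⊤ := by
  rw [Ideal.ne_top_iff_one, mem_hardVanishing_singleton, map_one]
  have : Nonempty (Fin n) := ⟨⟨0, n.pos⟩⟩
  exact one_ne_zero

theorem codim_hardVanishing_singleton_lt {n : ℕ+} (X : Fin g → Matrix (Fin n) (Fin n) 𝕜) :
    codim 𝕜 (hardVanishing {(⟨n, X⟩ : MatrixTuples 𝕜 g)}) < Cardinal.aleph0 := by
  rw [codim_lt_aleph0_iff]
  have : (hardVanishing {(⟨n, X⟩ : MatrixTuples 𝕜 g)}).restrictScalars 𝕜 =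
      LinearMap.ker (eval X).toLinearMap := by
    ext p
    exact mem_hardVanishing_singleton
  rw [this]
  exact Module.Finite.equiv (eval X).toLinearMap.quotKerEquivRange.symm

theorem exists_eq_hardVanishing_singleton (I : Ideal (FreeStarAlgebra 𝕜 g)) [I.IsTwoSided]
    (hI : IsRealIdeal I) (h0 : I ≠ ⊤) (hfin : codim 𝕜 I < Cardinal.aleph0) :
    ∃ (n : ℕ+) (X : Fin g → Matrix (Fin n) (Fin n) 𝕜), I = hardVanishing {⟨n, X⟩} := by
  have hstar := hI.isStarIdeal
  let _ : StarRing (FreeStarAlgebra 𝕜 g ⧸ I) := hstar.quotientStarRing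
  have hmk : ∀ p, star (Ideal.Quotient.mk I p) = Ideal.Quotient.mk I (star p) := star_mk_out hstar
  have : StarModule 𝕜 (FreeStarAlgebra 𝕜 g ⧸ I) := by
    refine ⟨fun c x => ?_⟩
    obtain ⟨p, rfl⟩ := Ideal.Quotient.mkₐ_surjective 𝕜 I x
    rw [← map_smul, Ideal.Quotient.mkₐ_eq_mk, hmk, hmk, star_smul, ← Ideal.Quotient.mkₐ_eq_mk 𝕜,
      map_smul]
  have : FiniteDimensional 𝕜 (FreeStarAlgebra 𝕜 g ⧸ I) := by
    have := codim_lt_aleph0_iff.1 hfin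
    exact Module.Finite.equiv (Submodule.Quotient.restrictScalarsEquiv 𝕜 I)
  have : Nontrivial (FreeStarAlgebra 𝕜 g ⧸ I) := Ideal.Quotient.nontrivial_iff.2 h0
  obtain ⟨n, φ, hinj, hφ⟩ := exists_injective_matrix_representation (𝕜 := 𝕜)
    (B := FreeStarAlgebra 𝕜 g ⧸ I) (by
      intro m b hb j
      choose a ha using fun j => Ideal.Quotient.mk_surjective (b j)
      rw [← ha j, Ideal.Quotient.eq_zero_iff_mem]
      refine hI m a ⟨∑ j, star (a j) * a j, ?_, 0, I.zero_mem, by simp⟩ j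
      rw [← Ideal.Quotient.eq_zero_iff_mem, ← hb]
      simp only [map_sum, map_mul, ← hmk, ha])
  let ψ := φ.comp (Ideal.Quotient.mkₐ 𝕜 I)
  have hψ : ∀ p, ψ (star p) = (ψ p).conjTranspose := fun p =>
    (congrArg φ (hmk p).symm).trans (hφ _)
  refine ⟨n, fun j => ψ (var 𝕜 j), ?_⟩
  ext p
  rw [mem_hardVanishing_singleton, ← eq_eval ψ hψ, ← Ideal.Quotient.eq_zero_iff_mem]
  exact (map_eq_zero_iff φ hinj).symm

end FreeStarAlgebra

open FreeStarAlgebra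

theorem proposition1p1 {𝕜 : Type*} [RCLike 𝕜] {g : ℕ} (I : Ideal (FreeStarAlgebra 𝕜 g))
    [I.IsTwoSided] :
    (I.FG ↔ I = ⊥ ∨ codim 𝕜 I < Cardinal.aleph0) ∧
    (IsStarIdeal I →
      ((IsRealIdeal I ∧ 0 < codim 𝕜 I ∧ codim 𝕜 I < Cardinal.aleph0) ↔
        ∃ (n : ℕ+) (X : Fin g → Matrix (Fin n) (Fin n) 𝕜), I = hardVanishing {⟨n, X⟩})) ∧
    (0 < codim 𝕜 (realRadical I) ∧ codim 𝕜 (realRadical I) < Cardinal.aleph0 →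
      hardRadical I = realRadical I) := by
  refine ⟨⟨fun h => ?_, ?_⟩, fun _ => ⟨?_, ?_⟩, ?_⟩
  · by_cases h0 : I = ⊥
    · exact Or.inl h0
    · exact Or.inr (codim_lt_aleph0_iff.2 (FreeMonoidAlgebra.finite_quotient_of_fg h h0))
  · rintro (rfl | h)
    · exact Submodule.fg_bot
    · exact FreeMonoidAlgebra.fg_of_finite_quotient I (codim_lt_aleph0_iff.1 h)
  · rintro ⟨hreal, hpos, hfin⟩
    exact exists_eq_hardVanishing_singleton I hreal (codim_pos_iff.1 hpos) hfin
  · rintro ⟨n, X, rfl⟩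
    exact ⟨isRealIdeal_hardVanishing _, codim_pos_iff.2 (hardVanishing_singleton_ne_top X),
      codim_hardVanishing_singleton_lt X⟩
  · rintro ⟨hpos, hfin⟩
    apply le_antisymm
    · obtain ⟨n, X, h⟩ := exists_eq_hardVanishing_singleton (realRadical I)
        (isRealIdeal_realRadical I) (codim_pos_iff.1 hpos) hfin
      -- `X` kills the real radical, hence `I`.
      have hX : (⟨n, X⟩ : MatrixTuples 𝕜 g) ∈ hardVariety I := fun p hp => by
        rw [← mem_hardVanishing_singleton, ← h]
        exact le_realRadical I hp
      rw [h]
      exact hardVanishing_anti (Set.singleton_subset_iff.2 hX)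
    · exact realRadical_le (fun p hp X hX => hX p hp) (isRealIdeal_hardVanishing _)
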